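/- Let $\Omega=\{0,1\}^{\mathbb N}$ be the Cantor space and $\mathcal M(\Omega)$ the set of all Borel probability measures on $\Omega$. For a finite binary word $x$ let $x\Omega$ be the set of sequences beginning with $x$. A basic open subset of $\Omega\times\mathcal M(\Omega)$ is a set $x\Omega\times\beta$, where $\beta$ consists of all $P\in\mathcal M(\Omega)$ satisfying a finite list of conditions $u<P(y\Omega)<v$ with $y$ a binary word and $u,v$ rational. A function $t:\Omega\times\mathcal M(\Omega)\to[0,\infty]$ is lower semicomputable if there is an algorithm that, given a rational $r$, enumerates basic open sets whose union is $\{(\omega,P): r<t(\omega,P)\}$. A uniform test is a lower semicomputable $t$ with $\int t(\omega,P)\,dP(\omega)\le 1$ for every $P\in\mathcal M(\Omega)$; it is universal if for every uniform test $s$ there is a constant $c<\infty$ with $s\le c\,t$ everywhere. A sequence $\omega$ is uniformly random with respect to $P$ if $s(\omega,P)<\infty$ for every uniform test $s$ (equivalently, if $t(\omega,P)<\infty$ for any one fixed universal uniform test $t$). A measure $N\in\mathcal M(\Omega)$ is neutral if every $\omega\in\Omega$ is uniformly random with respect to $N$. Theorem. There exists a neutral measure. Moreover, for every universal uniform test $t$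 there is a measure $N\in\mathcal M(\Omega)$ with $t(\omega,N)\le 1$ for all $\omega\in\Omega$; this $N$ is neutral. -/

import Mathlib

open MeasureTheory
open scoped ENNReal NNReal

noncomputable section

namespace UniformTests

/-- The binary Cantor space `Ω` of infinite binary sequences (product topology and product
`σ`-algebra). -/
abbrev Cantor : Type := ℕ → Bool

/-- The space `M(Ω)` of all Borel probability measures on `Ω`. -/
abbrev Measures : Type := ProbabilityMeasure Cantor

/-- The interval `xΩ` of all infinite sequences that begin with the finite word `x`. -/
def interval (x : List Bool) : Set Cantor :=
  {ω | ∀ i : Fin x.length, ω i = x.get i}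

/-- Names of rational numbers as finite objects: `(a, b, c)` names `(a - b) / (c + 1)`. -/
abbrev RatCode : Type := ℕ × ℕ × ℕ

/-- The rational number with a given name; every rational number has a name. -/
def RatCode.val (q : RatCode) : ℚ := ((q.1 : ℚ) - (q.2.1 : ℚ)) / ((q.2.2 : ℚ) + 1)

/-- A finite list of conditions `u < P(yΩ) < v`, each given by a word `y` and rationals `u`, `v`. -/
abbrev MeasureCode : Type := List (List Bool × RatCode × RatCode)

/-- The basic open set of measures given by a finite list of conditions `u < P(yΩ) < v`. -/
def basicMeasures (β : MeasureCode) : Set Measures :=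
  {P | ∀ c ∈ β, (c.2.1.val : ℝ) < (P : Measure Cantor).real (interval c.1) ∧
    (P : Measure Cantor).real (interval c.1) < (c.2.2.val : ℝ)}

/-- Names of basic open sets `xΩ × β` of `Ω × M(Ω)`. -/
abbrev RectCode : Type := List Bool × MeasureCode

/-- The basic open set `xΩ × β` of `Ω × M(Ω)`. -/
def basicRect (b : RectCode) : Set (Cantor × Measures) :=
  interval b.1 ×ˢ basicMeasures b.2

/-- `t : Ω × M(Ω) → [0, ∞]` is lower semicomputable: the set `{(ω, P) | r < t(ω, P)}` is effectively
open uniformly in the rational `r`, i.e. some algorithm, given `r`, enumerates basic open sets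
whose union is this set. -/
def LowerSemicomputable (t : Cantor → Measures → ℝ≥0∞) : Prop :=
  ∃ W : RatCode × RectCode → Prop, REPred W ∧
    ∀ r : RatCode,
      {p : Cantor × Measures | (((r.val : ℚ) : ℝ) : EReal) < ((t p.1 p.2 : ℝ≥0∞) : EReal)} =
        ⋃ b ∈ {b : RectCode | W (r, b)}, basicRect b

/-- A uniform test: a lower semicomputable function `t(ω, P)` of a sequence and a measure
with `∫ t(ω, P) dP(ω) ≤ 1` for every probability measure `P`. -/
structure IsUniformTest (t : Cantor → Measures → ℝ≥0∞) : Prop where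
  lowerSemicomputable : LowerSemicomputable t
  lintegral_le_one : ∀ P : Measures, ∫⁻ ω, t ω P ∂(P : Measure Cantor) ≤ 1

/-- A universal uniform test: a uniform test that is maximal up to a constant factor. -/
structure IsUniversalUniformTest (t : Cantor → Measures → ℝ≥0∞) : Prop where
  isUniformTest : IsUniformTest t
  maximal : ∀ s : Cantor → Measures → ℝ≥0∞, IsUniformTest s →
    ∃ c : ℝ≥0, ∀ ω P, s ω P ≤ (c : ℝ≥0∞) * t ω P

/-- `ω` is uniformly random with respect to `P`: every uniform test is finite at `(ω, P)`.
By `isUniformlyRandom_iff` below, this is the same as `t(ω, P) < ∞` for any one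
universal uniform test `t`. -/
def IsUniformlyRandom (ω : Cantor) (P : Measures) : Prop :=
  ∀ s : Cantor → Measures → ℝ≥0∞, IsUniformTest s → s ω P < ∞

/-- A measure is neutral if every sequence is uniformly random with respect to it. -/
def IsNeutral (N : Measures) : Prop :=
  ∀ ω : Cantor, IsUniformlyRandom ω N

theorem isUniformlyRandom_iff {t : Cantor → Measures → ℝ≥0∞} (ht : IsUniversalUniformTest t)
    (ω : Cantor) (P : Measures) : IsUniformlyRandom ω P ↔ t ω P < ∞ := by
  constructor
  · intro h
    exact h t ht.isUniformTest
  · intro h s hs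
    obtain ⟨c, hc⟩ := ht.maximal s hs
    exact lt_of_le_of_lt (hc ω P) (ENNReal.mul_lt_top ENNReal.coe_lt_top h)

end UniformTests

end

/-! Computability enters only through two consequences: a test is lower semicontinuous, and there
are only countably many tests.

Let `t` be lower semicontinuous with integral at most 1 against every measure. For finitely many
sequences `ω i`, consider the mixtures of their point masses, indexed by a simplex. The sets where
`t (ω i) ≤ 1` are closed. If `t (ω i) > 1` held at every `i` of positive weight, the integral
against the mixture would exceed 1; so each mixture lies in the set of some `i` in its support. This
is the hypothesis of the Knaster–Kuratowski–Mazurkiewicz lemma, which gives one mixture good for all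
`ω i`. Compactness of `M(Ω)` passes from finite sets to all of `Ω` (`exists_forall_le_one`).

The existence of a neutral measure does not rely on a universal test: the same result is applied to
a weighted sum of all tests, which need not be computable.

KKM itself is derived from Scarf's lemma, a door-and-room parity argument on finite sets with
several linear orders, applied to finer and finer grids in the simplex. -/

namespace UniformTests

/-! ### Scarf's combinatorial lemma -/

/-- A set of points is dominated if no point lies strictly above its minimum in every order. -/
def Dominated {I X L : Type*} [LE L] (r : I → X → L) (S : Finset X) : Prop :=
  ∀ y, ∃ i, ∀ s ∈ S, r i y ≤ r i s

theorem Dominated.mono {I X L : Type*} [LE L] {r : I → X → L} {S S' : Finset X}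
    (h : Dominated r S) (hS : S' ⊆ S) : Dominated r S' := fun y =>
  let ⟨i, hi⟩ := h y
  ⟨i, fun s hs => hi s (hS hs)⟩

/-- `f` identifies exactly one pair of points of `D`, and the removable points are the two members
of that pair. This supplies every "exactly two" in the parity count. -/
theorem card_filter_image_erase {α β : Type*} [DecidableEq α] [DecidableEq β] {D : Finset α}
    {τ : Finset β} {f : α → β} (h : D.image f = τ) (hc : D.card = τ.card + 1) :
    (D.filter fun j => (D.erase j).image f = τ).card = 2 := by
  have hni : ¬ Set.InjOn f D := by
    intro hi
    have := Finset.card_image_iff.2 hi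
    rw [h] at this
    omega
  simp only [Set.InjOn, not_forall] at hni
  obtain ⟨a, ha, b, hb, hab, hne⟩ := hni
  have key : ∀ a ∈ D, ∀ b ∈ D, f a = f b → a ≠ b → (D.erase a).image f = τ := by
    intro a ha b hb hab hne
    rw [← h]
    ext y
    simp only [Finset.mem_image, Finset.mem_erase]
    constructor
    · rintro ⟨x, ⟨_, hx⟩, rfl⟩
      exact ⟨x, hx, rfl⟩
    · rintro ⟨x, hx, rfl⟩
      by_cases hxa : x = a
      · subst hxa
        exact ⟨b, ⟨hne.symm, hb⟩, hab.symm⟩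
      · exact ⟨x, ⟨hxa, hx⟩, rfl⟩
  have : (D.filter fun j => (D.erase j).image f = τ) = {a, b} := by
    ext j
    simp only [Finset.mem_filter, Finset.mem_insert, Finset.mem_singleton]
    constructor
    · rintro ⟨hj, hjτ⟩
      by_contra hcon
      push Not at hcon
      have hinj : Set.InjOn f (D.erase j) := by
        rw [← Finset.card_image_iff, hjτ, Finset.card_erase_of_mem hj]
        omega
      exact hne (hinj (Finset.mem_coe.2 (Finset.mem_erase.2 ⟨Ne.symm hcon.1, ha⟩))
        (Finset.mem_coe.2 (Finset.mem_erase.2 ⟨Ne.symm hcon.2, hb⟩)) hab)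
    · rintro (rfl | rfl)
      · exact ⟨ha, key _ ha _ hb hab hne⟩
      · exact ⟨hb, key _ hb _ ha hab.symm (Ne.symm hne)⟩
  rw [this, Finset.card_pair hne]

theorem image_min_eq {I X L : Type*} [Fintype I] [DecidableEq X] [LinearOrder L]
    {r : I → X → L} (hr : ∀ i, Function.Injective (r i)) {τ : Finset X}
    (hτ : Dominated r τ) {m : I → X} (hm : ∀ i, m i ∈ τ) (hmin : ∀ i, ∀ x ∈ τ, r i (m i) ≤ r i x) :
    Finset.univ.image m = τ := by
  ext y
  simp only [Finset.mem_image, Finset.mem_univ, true_and]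
  constructor
  · rintro ⟨i, rfl⟩
    exact hm i
  · intro hy
    obtain ⟨i, hi⟩ := hτ y
    exact ⟨i, hr i (le_antisymm (hmin i y hy) (hi _ (hm i)))⟩

section Scarf

variable {I X L : Type*} [Fintype I] [DecidableEq I] [Fintype X] [DecidableEq X] [LinearOrder L]

open Classical in
-- The pivot step. A point completing `τ` to a dominated set is minimal in exactly one order `j`;
-- the other orders must keep their minima in `τ`, and the new point is the `r j`-largest among
-- those above these minima. So completions correspond to the admissible `j`.
theorem card_dominated_supersets {r : I → X → L} (hr : ∀ i, Function.Injective (r i))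
    {τ : Finset X} (hτ : Dominated r τ) (hc : Fintype.card I = τ.card + 1)
    {m : I → X} (hm : ∀ i, m i ∈ τ) (hmin : ∀ i, ∀ x ∈ τ, r i (m i) ≤ r i x) :
    (Finset.univ.filter fun S : Finset X =>
        (S.card = Fintype.card I ∧ Dominated r S) ∧ τ ⊆ S).card =
      (Finset.univ.filter fun j : I => (Finset.univ.erase j).image m = τ ∧
        ∃ y, ∀ i, i ≠ j → r i (m i) < r i y).card := by
  -- `w j` is the pivot point for `j`; it is the irrelevant default `m j` when no point lies above
  -- the other minima.
  have hw : ∀ j, ∃ w, (∃ y, ∀ i, i ≠ j → r i (m i) < r i y) →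
      (∀ i, i ≠ j → r i (m i) < r i w) ∧
        ∀ y, (∀ i, i ≠ j → r i (m i) < r i y) → r j y ≤ r j w := by
    intro j
    by_cases h : ∃ y, ∀ i, i ≠ j → r i (m i) < r i y
    · obtain ⟨y, hy⟩ := h
      obtain ⟨w, hw, hmax⟩ := Finset.exists_max_image
        (Finset.univ.filter fun y => ∀ i, i ≠ j → r i (m i) < r i y) (r j) ⟨y, by simpa using hy⟩
      exact ⟨w, fun _ => ⟨by simpa using hw, fun y hy => hmax y (by simpa using hy)⟩⟩
    · exact ⟨m j, fun h' => absurd h' h⟩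
  choose w hw using hw
  have hle : ∀ j x, (∀ i, i ≠ j → r i (m i) < r i x) → ∀ s ∈ τ, r j x ≤ r j s := by
    intro j x hx
    obtain ⟨i, hi⟩ := hτ x
    by_cases hij : i = j
    · exact hij ▸ hi
    · exact absurd (hi _ (hm i)) (not_le.2 (hx i hij))
  have hnot : ∀ j, (Finset.univ.erase j).image m = τ → ∀ x,
      (∀ i, i ≠ j → r i (m i) < r i x) → x ∉ τ := by
    intro j hj x hx hxτ
    rw [← hj] at hxτ
    simp only [Finset.mem_image, Finset.mem_erase, Finset.mem_univ, and_true] at hxτ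
    obtain ⟨i, hij, rfl⟩ := hxτ
    exact lt_irrefl _ (hx i hij)
  symm
  refine Finset.card_bij (fun j _ => insert (w j) τ) ?_ ?_ ?_
  · intro j hj
    simp only [Finset.mem_filter, Finset.mem_univ, true_and] at hj ⊢
    obtain ⟨hgood, hne⟩ := hj
    obtain ⟨hw1, hw2⟩ := hw j hne
    refine ⟨⟨?_, ?_⟩, Finset.subset_insert _ _⟩
    · rw [Finset.card_insert_of_notMem (hnot j hgood _ hw1), hc]
    · intro y
      by_cases hy : ∀ i, i ≠ j → r i (m i) < r i y
      · refine ⟨j, fun s hs => ?_⟩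
        rcases Finset.mem_insert.1 hs with rfl | hs
        · exact hw2 y hy
        · exact (hw2 y hy).trans (hle j _ hw1 s hs)
      · push Not at hy
        obtain ⟨i, hij, hi⟩ := hy
        refine ⟨i, fun s hs => ?_⟩
        rcases Finset.mem_insert.1 hs with rfl | hs
        · exact hi.trans (hw1 i hij).le
        · exact hi.trans (hmin i s hs)
  · intro j hj k hk hjk
    simp only [Finset.mem_filter, Finset.mem_univ, true_and] at hj hk
    obtain ⟨hw1, -⟩ := hw j hj.2
    obtain ⟨hv1, -⟩ := hw k hk.2
    have hmem : w j ∈ insert (w k) τ := hjk ▸ Finset.mem_insert_self _ _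
    have hwk : w j = w k := (Finset.mem_insert.1 hmem).resolve_right (hnot j hj.1 _ hw1)
    by_contra hne
    have h1 := hv1 j hne
    rw [← hwk] at h1
    exact not_le.2 h1 (hle j _ hw1 _ (hm j))
  · intro S hS
    simp only [Finset.mem_filter, Finset.mem_univ, true_and] at hS
    obtain ⟨⟨hScard, hSd⟩, hτS⟩ := hS
    obtain ⟨x, hx⟩ : ∃ x, S \ τ = {x} := by
      rw [← Finset.card_eq_one, Finset.card_sdiff_of_subset hτS]
      omega
    have hxS : x ∈ S ∧ x ∉ τ := by
      rw [← Finset.mem_sdiff, hx]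
      exact Finset.mem_singleton_self x
    have hSx : insert x τ = S := by
      rw [Finset.insert_eq, ← hx, Finset.sdiff_union_of_subset hτS]
    -- `j` is an order in which the added point `x` is minimal in `S`. Each point of `τ` is then
    -- minimal in `S` in some other order, so counting makes `m` injective off `j`.
    obtain ⟨j, hj⟩ := hSd x
    have hz : ∀ z ∈ τ, ∃ i, i ≠ j ∧ m i = z ∧ ∀ s ∈ S, r i z ≤ r i s := by
      intro z hz
      obtain ⟨i, hi⟩ := hSd z
      refine ⟨i, ?_, hr i (le_antisymm (hmin i z hz) (hi _ (hτS (hm i)))), hi⟩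
      rintro rfl
      have : x = z := hr i (le_antisymm (hj z (hτS hz)) (hi x hxS.1))
      exact hxS.2 (this ▸ hz)
    have hgood : (Finset.univ.erase j).image m = τ := by
      ext z
      simp only [Finset.mem_image, Finset.mem_erase, Finset.mem_univ, and_true]
      constructor
      · rintro ⟨i, _, rfl⟩
        exact hm i
      · intro h
        obtain ⟨i, h1, h2, _⟩ := hz z h
        exact ⟨i, h1, h2⟩
    have hinj : Set.InjOn m ((Finset.univ.erase j : Finset I) : Set I) := by
      rw [← Finset.card_image_iff, hgood, Finset.card_erase_of_mem (Finset.mem_univ j),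
        Finset.card_univ]
      omega
    have hxM : ∀ i, i ≠ j → r i (m i) < r i x := by
      intro i hij
      obtain ⟨i', h1, h2, h3⟩ := hz (m i) (hm i)
      have : i' = i := hinj (by simpa using h1) (by simpa using hij) h2
      subst this
      refine lt_of_le_of_ne (h3 x hxS.1) fun h => hxS.2 ?_
      rw [← hr i' h]
      exact hm i'
    have hex : ∃ y, ∀ i, i ≠ j → r i (m i) < r i y := ⟨x, hxM⟩
    refine ⟨j, by simpa using ⟨hgood, hex⟩, ?_⟩
    obtain ⟨hw1, hw2⟩ := hw j hex
    have hwx : w j = x := by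
      refine hr j (le_antisymm ?_ (hw2 x hxM))
      obtain ⟨i, hi⟩ := hSd (w j)
      by_cases hij : i = j
      · exact hij ▸ hi x hxS.1
      · exact absurd (hi _ (hτS (hm i))) (not_le.2 (hw1 i hij))
    rw [hwx, hSx]

open Classical in
/-- Scarf's combinatorial lemma: `e i` is a slack point, lowest in the order `i` and above all
non-slack points in the other orders. -/
theorem exists_dominated_rainbow [Nontrivial I] {r : I → X → L}
    (hr : ∀ i, Function.Injective (r i)) {e : I → X} (he : ∀ i x, r i (e i) ≤ r i x)
    (he' : ∀ i j x, j ≠ i → x ∉ Set.range e → r i x < r i (e j)) {g : X → I}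
    (hg : ∀ i, g (e i) = i) :
    ∃ S : Finset X, Dominated r S ∧ ∀ i, ∃ s ∈ S, g s = i := by
  by_contra hcon
  have hnc : ∀ S : Finset X, Dominated r S → S.image g ≠ Finset.univ := by
    intro S hS himg
    refine hcon ⟨S, hS, fun i => ?_⟩
    have : i ∈ S.image g := himg ▸ Finset.mem_univ i
    simpa using this
  obtain ⟨i₀⟩ : Nonempty I := inferInstance
  have hI : 1 < Fintype.card I := Fintype.one_lt_card
  have heinj : Function.Injective e := Function.LeftInverse.injective hg
  have helt : ∀ i j, j ≠ i → r i (e i) < r i (e j) := fun i j hij =>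
    lt_of_le_of_ne (he i _) fun h => hij (heinj (hr i h)).symm
  -- Doors carry every color except `i₀`. Without a rainbow room, each room has 0 or 2 doors, while
  -- each door opens into 2 rooms, except `τ₀`, which opens into one: the incidences would be both
  -- even and odd.
  set rooms : Finset (Finset X) :=
    Finset.univ.filter fun S => S.card = Fintype.card I ∧ Dominated r S with hrooms
  set doors : Finset (Finset X) := Finset.univ.filter fun τ =>
    Fintype.card I = τ.card + 1 ∧ Dominated r τ ∧ τ.image g = Finset.univ.erase i₀ with hdoors
  have hcount := Finset.sum_card_bipartiteAbove_eq_sum_card_bipartiteBelow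
    (s := doors) (t := rooms) (fun τ S => τ ⊆ S)
  have hbelow : ∀ S ∈ rooms, Even (doors.bipartiteBelow (fun τ S => τ ⊆ S) S).card := by
    intro S hS
    simp only [hrooms, Finset.mem_filter, Finset.mem_univ, true_and] at hS
    have hcard : (doors.bipartiteBelow (fun τ S => τ ⊆ S) S).card =
        (S.filter fun x => (S.erase x).image g = Finset.univ.erase i₀).card := by
      symm
      refine Finset.card_bij (fun x _ => S.erase x) ?_ ?_ ?_
      · intro x hx
        simp only [Finset.mem_filter] at hx
        simp only [Finset.bipartiteBelow, hdoors, Finset.mem_filter, Finset.mem_univ, true_and]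
        refine ⟨⟨?_, hS.2.mono (Finset.erase_subset _ _), hx.2⟩, Finset.erase_subset _ _⟩
        rw [Finset.card_erase_add_one hx.1, hS.1]
      · intro x hx y hy hxy
        simp only [Finset.mem_filter] at hx hy
        exact Finset.erase_injOn S hx.1 hy.1 hxy
      · intro τ hτ
        simp only [Finset.bipartiteBelow, hdoors, Finset.mem_filter, Finset.mem_univ,
          true_and] at hτ
        obtain ⟨⟨h1, -, h3⟩, h4⟩ := hτ
        obtain ⟨x, hx⟩ : ∃ x, S \ τ = {x} := by
          rw [← Finset.card_eq_one, Finset.card_sdiff_of_subset h4]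
          omega
        have hxS : x ∈ S ∧ x ∉ τ := by
          rw [← Finset.mem_sdiff, hx]
          exact Finset.mem_singleton_self x
        have hτx : S.erase x = τ := by
          rw [← Finset.sdiff_singleton_eq_erase, ← hx, Finset.sdiff_sdiff_eq_self h4]
        exact ⟨x, by simpa [hτx] using ⟨hxS.1, h3⟩, hτx⟩
    rw [hcard]
    by_cases himg : S.image g = Finset.univ.erase i₀
    · rw [card_filter_image_erase himg (by
        rw [Finset.card_erase_of_mem (Finset.mem_univ _), Finset.card_univ, hS.1]; omega)]
      exact even_two
    · rw [Finset.filter_false_of_mem]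
      · simp
      · intro x hx hxe
        have hins : S.image g = insert (g x) (Finset.univ.erase i₀) := by
          rw [← hxe, ← Finset.image_insert, Finset.insert_erase hx]
        by_cases hgx : g x = i₀
        · rw [hgx, Finset.insert_erase (Finset.mem_univ _)] at hins
          exact hnc S hS.2 hins
        · rw [Finset.insert_eq_self.2 (by simpa using hgx)] at hins
          exact himg hins
  set τ₀ : Finset X := (Finset.univ.erase i₀).image e with hτ₀
  have hτ₀mem : ∀ k, k ≠ i₀ → e k ∈ τ₀ := fun k hk =>
    Finset.mem_image_of_mem e (by simpa using hk)
  have hτ₀' : ∀ x ∈ τ₀, ∃ k, k ≠ i₀ ∧ e k = x := by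
    intro x hx
    simpa [hτ₀] using hx
  have hτ₀door : τ₀ ∈ doors := by
    simp only [hdoors, Finset.mem_filter, Finset.mem_univ, true_and]
    refine ⟨?_, ?_, ?_⟩
    · rw [hτ₀, Finset.card_image_of_injective _ heinj,
        Finset.card_erase_add_one (Finset.mem_univ _), Finset.card_univ]
    · intro y
      by_cases hy : y ∈ Set.range e
      · obtain ⟨j, rfl⟩ := hy
        exact ⟨j, fun s _ => he j s⟩
      · refine ⟨i₀, fun s hs => ?_⟩
        obtain ⟨k, hk, rfl⟩ := hτ₀' s hs
        exact (he' i₀ k y hk hy).le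
    · rw [hτ₀, Finset.image_image]
      have : g ∘ e = id := funext hg
      rw [this, Finset.image_id]
  have hmins : ∀ τ ∈ doors, ∃ m : I → X, (∀ i, m i ∈ τ) ∧ ∀ i, ∀ x ∈ τ, r i (m i) ≤ r i x := by
    intro τ hτ
    simp only [hdoors, Finset.mem_filter, Finset.mem_univ, true_and] at hτ
    have hne : τ.Nonempty := Finset.card_pos.1 (by omega)
    choose m hm hm' using fun i => Finset.exists_min_image τ (r i) hne
    exact ⟨m, hm, hm'⟩
  have habove : ∀ τ ∈ doors, τ ≠ τ₀ →
      Even (rooms.bipartiteAbove (fun τ S => τ ⊆ S) τ).card := by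
    intro τ hτ hne
    obtain ⟨m, hm, hmin⟩ := hmins τ hτ
    simp only [hdoors, Finset.mem_filter, Finset.mem_univ, true_and] at hτ
    obtain ⟨h1, h2, h3⟩ := hτ
    rw [Finset.bipartiteAbove, hrooms, Finset.filter_filter,
      card_dominated_supersets hr h2 h1 hm hmin]
    -- The slack point `e j` serves, unless some `m i` is a slack point `e k` with `k ≠ i`. Then `τ`
    -- consists of slack points and omits `e i`, so `i = i₀` and `τ = τ₀`.
    have hM : ∀ j, ∃ y, ∀ i, i ≠ j → r i (m i) < r i y := by
      intro j
      refine ⟨e j, fun i hij => ?_⟩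
      by_cases hmi : m i ∈ Set.range e
      · obtain ⟨k, hk⟩ := hmi
        by_cases hki : k = i
        · rw [← hk, hki]
          exact helt i j hij.symm
        · exfalso
          have hslack : ∀ s ∈ τ, s ∈ Set.range e := by
            intro s hs
            by_contra hs'
            exact not_le.2 (he' i k s hki hs') (hk ▸ hmin i s hs)
          have hei : e i ∉ τ := by
            intro hei
            have := hmin i _ hei
            rw [← hk] at this
            exact not_le.2 (helt i k hki) this
          have hi : i ∉ τ.image g := by
            simp only [Finset.mem_image, not_exists, not_and]
            rintro s hs hgs
            obtain ⟨l, rfl⟩ := hslack s hs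
            rw [hg] at hgs
            exact hei (hgs ▸ hs)
          have hii : i = i₀ := by
            rw [h3] at hi
            simpa using hi
          subst hii
          refine hne (Finset.eq_of_subset_of_card_le ?_ ?_)
          · intro s hs
            obtain ⟨l, rfl⟩ := hslack s hs
            exact hτ₀mem l fun h => hei (h ▸ hs)
          · rw [hτ₀, Finset.card_image_of_injective _ heinj,
              Finset.card_erase_of_mem (Finset.mem_univ _), Finset.card_univ]
            omega
      · exact he' i j _ hij.symm hmi
    have : (Finset.univ.filter fun j : I => (Finset.univ.erase j).image m = τ ∧
        ∃ y, ∀ i, i ≠ j → r i (m i) < r i y) =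
        Finset.univ.filter fun j : I => (Finset.univ.erase j).image m = τ :=
      Finset.filter_congr fun j _ => and_iff_left (hM j)
    rw [this, card_filter_image_erase (image_min_eq hr h2 hm hmin)
      (by rw [Finset.card_univ]; exact h1)]
    exact even_two
  have hout : (rooms.bipartiteAbove (fun τ S => τ ⊆ S) τ₀).card = 1 := by
    obtain ⟨m, hm, hmin⟩ := hmins τ₀ hτ₀door
    have hd := hτ₀door
    simp only [hdoors, Finset.mem_filter, Finset.mem_univ, true_and] at hd
    obtain ⟨h1, h2, h3⟩ := hd
    rw [Finset.bipartiteAbove, hrooms, Finset.filter_filter,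
      card_dominated_supersets hr h2 h1 hm hmin, Finset.card_eq_one]
    have hme : ∀ k, k ≠ i₀ → m k = e k := fun k hk =>
      hr k (le_antisymm (hmin k _ (hτ₀mem k hk)) (he k _))
    refine ⟨i₀, ?_⟩
    ext j
    simp only [Finset.mem_filter, Finset.mem_univ, true_and, Finset.mem_singleton]
    constructor
    -- Another `j` would need `m i₀ = e j`. A point above `e j` in order `i₀` is a slack point `e k`
    -- with `k` different from `i₀` and `j`, and it cannot exceed `m k = e k` in order `k`.
    · rintro ⟨hgood, y, hy⟩
      by_contra hj
      have hej := hτ₀mem j hj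
      rw [← hgood] at hej
      simp only [Finset.mem_image, Finset.mem_erase, Finset.mem_univ, and_true] at hej
      obtain ⟨i, hij, hi⟩ := hej
      have hii : i = i₀ := by
        by_contra hii
        rw [hme i hii] at hi
        exact hij (heinj hi)
      subst hii
      have hy0 := hy i hij
      rw [hi] at hy0
      by_cases hyr : y ∈ Set.range e
      · obtain ⟨k, rfl⟩ := hyr
        by_cases hki : k = i
        · subst hki
          exact not_le.2 hy0 (he k _)
        · by_cases hkj : k = j
          · subst hkj
            exact lt_irrefl _ hy0
          · have := hy k hkj
            rw [hme k hki] at this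
            exact lt_irrefl _ this
      · exact lt_asymm hy0 (he' i j y hj hyr)
    · rintro rfl
      refine ⟨Finset.image_congr fun k hk => hme k (by simpa using hk), e j, fun i hij => ?_⟩
      rw [hme i hij]
      exact helt i j hij.symm
  rw [← Finset.add_sum_erase _ _ hτ₀door, hout] at hcount
  have heven1 : Even (∑ τ ∈ doors.erase τ₀,
      (rooms.bipartiteAbove (fun τ S => τ ⊆ S) τ).card) :=
    Finset.even_sum _ fun τ hτ =>
      habove τ (Finset.mem_of_mem_erase hτ) (Finset.ne_of_mem_erase hτ)
  have heven2 := Finset.even_sum _ hbelow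
  rw [← hcount] at heven2
  rw [Nat.even_add] at heven2
  exact absurd (heven2.2 heven1) (by decide)

end Scarf

/-! ### From Scarf's lemma to the KKM lemma -/

/-- Every coloring of the integer points of the simplex `∑ x i = m` has a point `q` that, for each
color, lies near a point of that color or near the corresponding face. -/
theorem exists_near_all_colors {I : Type*} [Fintype I] [Nontrivial I] (m : ℕ)
    (c : (I → ℕ) → I) :
    ∃ q : I → ℕ, ∑ i, q i = m ∧ ∀ i, q i ≤ Fintype.card I ∨
      ∃ x : I → ℕ, ∑ i, x i = m ∧ c x = i ∧
        ∀ j, x j ≤ q j + Fintype.card I ∧ q j ≤ x j + Fintype.card I := by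
  classical
  let T := {x : I → ℕ // x ∈ Finset.piAntidiag (Finset.univ : Finset I) m}
  have hT : ∀ x : T, ∑ i, x.1 i = m := fun x => (Finset.mem_piAntidiag.1 x.2).1
  have hT' : ∀ x : I → ℕ, ∑ i, x i = m → ∃ y : T, y.1 = x := fun x hx =>
    ⟨⟨x, Finset.mem_piAntidiag.2 ⟨hx, fun _ _ => Finset.mem_univ _⟩⟩, rfl⟩
  -- The values -1 and `m + 1` put slack points strictly outside the coordinate range `0..m`. The
  -- enumeration below only breaks ties.
  let pos : I → T ⊕ I → ℤ := fun i =>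
    Sum.elim (fun x => (x.1 i : ℤ)) (fun k => if i = k then -1 else m + 1)
  let r : I → T ⊕ I → ℤ ×ₗ Fin (Fintype.card (T ⊕ I)) := fun i x =>
    toLex (pos i x, Fintype.equivFin (T ⊕ I) x)
  have hlt : ∀ i x y, pos i x < pos i y → r i x < r i y := fun i x y h =>
    Prod.Lex.toLex_lt_toLex.2 (Or.inl h)
  have hle : ∀ i x y, r i x ≤ r i y → pos i x ≤ pos i y := fun i x y h =>
    not_lt.1 fun h' => not_le.2 (hlt i y x h') h
  have hposT : ∀ i (x : T), pos i (Sum.inl x) = (x.1 i : ℤ) := fun _ _ => rfl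
  have hposI : ∀ i, pos i (Sum.inr i) = -1 := fun i => by simp [pos]
  have hposI' : ∀ i j, j ≠ i → pos i (Sum.inr j) = m + 1 := fun i j h => by
    simp [pos, h.symm]
  have hxm : ∀ (x : T) i, x.1 i ≤ m := fun x i =>
    (Finset.single_le_sum (f := x.1) (fun _ _ => Nat.zero_le _) (Finset.mem_univ i)).trans_eq (hT x)
  obtain ⟨S, hS, hcol⟩ := exists_dominated_rainbow (I := I) (r := r) (e := Sum.inr)
    (g := Sum.elim (fun x => c x.1) id)
    (fun i x y h => (Fintype.equivFin (T ⊕ I)).injective (congrArg (fun z => (ofLex z).2) h))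
    (by
      intro i x
      by_cases hx : x = Sum.inr i
      · rw [hx]
      · refine (hlt _ _ _ ?_).le
        rw [hposI]
        rcases x with x | j
        · rw [hposT]
          omega
        · rw [hposI' i j (by rintro rfl; exact hx rfl)]
          omega)
    (by
      intro i j x hji hx
      rcases x with x | k
      · refine hlt _ _ _ ?_
        rw [hposT, hposI' i j hji]
        have := hxm x i
        omega
      · exact absurd ⟨k, rfl⟩ hx)
    (fun i => rfl)
  set C : Finset I := Finset.univ.filter fun i => Sum.inr i ∉ S with hC
  have hcolC : ∀ i ∈ C, ∃ x : T, Sum.inl x ∈ S ∧ c x.1 = i := by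
    intro i hi
    obtain ⟨s, hs, hsi⟩ := hcol i
    rcases s with x | k
    · exact ⟨x, hs, hsi⟩
    · have hk : k = i := hsi
      subst hk
      simp only [hC, Finset.mem_filter, Finset.mem_univ, true_and] at hi
      exact absurd hs hi
  have hdom : ∀ y : I → ℕ, ∑ i, y i = m → ∃ i ∈ C, ∀ x : T, Sum.inl x ∈ S → y i ≤ x.1 i := by
    intro y hy
    obtain ⟨y, rfl⟩ := hT' y hy
    obtain ⟨i, hi⟩ := hS (Sum.inl y)
    refine ⟨i, ?_, fun x hx => ?_⟩
    · simp only [hC, Finset.mem_filter, Finset.mem_univ, true_and]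
      intro h
      have := hle _ _ _ (hi _ h)
      rw [hposT, hposI] at this
      omega
    · have := hle _ _ _ (hi _ hx)
      rw [hposT, hposT] at this
      exact_mod_cast this
  obtain ⟨i₁⟩ : Nonempty I := inferInstance
  obtain ⟨i₀, hi₀, -⟩ := hdom (Pi.single i₁ m) (by simp)
  obtain ⟨q, hqS, -⟩ := hcolC i₀ hi₀
  have hmin : ∀ i, ∃ a : T, Sum.inl a ∈ S ∧ ∀ x : T, Sum.inl x ∈ S → a.1 i ≤ x.1 i := by
    intro i
    obtain ⟨a, ha, hmin⟩ := Finset.exists_min_image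
      (Finset.univ.filter fun x : T => Sum.inl x ∈ S) (fun x => x.1 i) ⟨q, by simpa using hqS⟩
    exact ⟨a, by simpa using ha, fun x hx => hmin x (by simpa using hx)⟩
  choose a ha hamin using hmin
  -- Otherwise raise every minimal coordinate in `C` by 1 and put the surplus on `i₀`: the resulting
  -- grid point contradicts domination. Hence the grid points of `S` are within `Fintype.card I` of
  -- each other in each coordinate.
  have hsum : m < ∑ i ∈ C, ((a i).1 i + 1) := by
    by_contra hcon
    push Not at hcon
    obtain ⟨i, hiC, hi⟩ := hdom (fun i => (if i ∈ C then (a i).1 i + 1 else 0) +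
      if i = i₀ then m - ∑ i ∈ C, ((a i).1 i + 1) else 0) (by
        rw [Finset.sum_add_distrib, Finset.sum_ite_eq' Finset.univ i₀,
          if_pos (Finset.mem_univ _), Finset.sum_ite_mem, Finset.univ_inter]
        omega)
    have := hi (a i) (ha i)
    simp only [if_pos hiC] at this
    omega
  have hCcard : C.card ≤ Fintype.card I := Finset.card_le_univ C
  have hsum' : ∑ i ∈ C, ((a i).1 i + 1) = ∑ i ∈ C, (a i).1 i + C.card := by
    rw [Finset.sum_add_distrib, Finset.sum_const, smul_eq_mul, mul_one]
  have hin : ∀ x : T, Sum.inl x ∈ S → ∀ i ∈ C, x.1 i ≤ (a i).1 i + Fintype.card I := by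
    intro x hx i hi
    have h1 : ∑ j ∈ C, x.1 j ≤ m :=
      (Finset.sum_le_sum_of_subset (Finset.subset_univ _)).trans_eq (hT x)
    have h2 : ∑ j ∈ C.erase i, (a j).1 j ≤ ∑ j ∈ C.erase i, x.1 j :=
      Finset.sum_le_sum fun j _ => hamin j x hx
    rw [← Finset.add_sum_erase _ _ hi] at h1 hsum'
    rw [← Finset.add_sum_erase _ (fun j => (a j).1 j) hi] at hsum'
    rw [← Finset.add_sum_erase _ _ hi] at hsum
    omega
  have hout : ∀ x : T, Sum.inl x ∈ S → ∀ i ∉ C, x.1 i ≤ Fintype.card I := by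
    intro x hx i hi
    have h1 : x.1 i + ∑ j ∈ C, x.1 j ≤ m := by
      rw [← Finset.sum_insert hi]
      exact (Finset.sum_le_sum_of_subset (Finset.subset_univ _)).trans_eq (hT x)
    have h2 : ∑ j ∈ C, (a j).1 j ≤ ∑ j ∈ C, x.1 j :=
      Finset.sum_le_sum fun j _ => hamin j x hx
    omega
  refine ⟨q.1, hT q, fun i => ?_⟩
  by_cases hi : i ∈ C
  · obtain ⟨x, hxS, hxi⟩ := hcolC i hi
    refine Or.inr ⟨x.1, hT x, hxi, fun j => ?_⟩
    by_cases hj : j ∈ C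
    · have h1 := hin x hxS j hj
      have h2 := hin q hqS j hj
      have h3 := hamin j x hxS
      have h4 := hamin j q hqS
      omega
    · have h1 := hout x hxS j hj
      have h2 := hout q hqS j hj
      omega
  · exact Or.inl (hout q hqS i hi)

/-- A closed cover of the simplex whose members contain the opposite faces has a common point. -/
theorem exists_mem_of_faces_subset {I : Type*} [Fintype I] [Nontrivial I] (G : I → Set (I → ℝ))
    (hG : ∀ i, IsClosed (G i)) (hcover : ∀ x ∈ stdSimplex ℝ I, ∃ i, x ∈ G i)
    (hface : ∀ x ∈ stdSimplex ℝ I, ∀ i, x i = 0 → x ∈ G i) :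
    ∃ p ∈ stdSimplex ℝ I, ∀ i, p ∈ G i := by
  have hscale : ∀ (k : ℕ) (x : I → ℕ), ∑ i, x i = k + 1 →
      (fun i => (x i : ℝ) / (k + 1)) ∈ stdSimplex ℝ I := by
    intro k x hx
    refine ⟨fun i => by positivity, ?_⟩
    rw [← Finset.sum_div, ← Nat.cast_sum, hx]
    push_cast
    exact div_self (by positivity)
  have hq : ∀ k : ℕ, ∃ q : I → ℕ, ∑ i, q i = k + 1 ∧ ∀ i, q i ≤ Fintype.card I ∨
      ∃ x : I → ℕ, ((fun j => (x j : ℝ) / (k + 1)) ∈ G i) ∧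
        ∀ j, x j ≤ q j + Fintype.card I ∧ q j ≤ x j + Fintype.card I := by
    intro k
    have hc : ∀ x : I → ℕ, ∃ i, ∑ i, x i = k + 1 → (fun j => (x j : ℝ) / (k + 1)) ∈ G i := by
      intro x
      by_cases hx : ∑ i, x i = k + 1
      · obtain ⟨i, hi⟩ := hcover _ (hscale k x hx)
        exact ⟨i, fun _ => hi⟩
      · exact ⟨Classical.arbitrary I, fun h => absurd h hx⟩
    choose c hc using hc
    obtain ⟨q, hq1, hq2⟩ := exists_near_all_colors (k + 1) c
    refine ⟨q, hq1, fun i => (hq2 i).imp_right ?_⟩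
    rintro ⟨x, hx, rfl, h⟩
    exact ⟨x, hc x hx, h⟩
  choose q hq1 hq2 using hq
  obtain ⟨p, hp, φ, hφ, hlim⟩ := (isCompact_stdSimplex ℝ I).tendsto_subseq
    (fun k => hscale k (q k) (hq1 k))
  refine ⟨p, hp, fun i => ?_⟩
  by_contra hpi
  have hp0 : 0 < p i := lt_of_le_of_ne (hp.1 i) fun h => hpi (hface p hp i h.symm)
  obtain ⟨ε, hε, hball⟩ := Metric.isOpen_iff.1 (hG i).isOpen_compl p hpi
  have hlim0 : Filter.Tendsto (fun k => (Fintype.card I : ℝ) / ((φ k : ℝ) + 1))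
      Filter.atTop (nhds 0) := by
    have h := (tendsto_const_div_atTop_nhds_zero_nat (Fintype.card I : ℝ)).comp
      ((Filter.tendsto_add_atTop_nat 1).comp hφ.tendsto_atTop)
    refine h.congr fun k => ?_
    simp
  have hlimi : Filter.Tendsto (fun k => (q (φ k) i : ℝ) / ((φ k : ℝ) + 1))
      Filter.atTop (nhds (p i)) := (tendsto_pi_nhds.1 hlim) i
  have e1 := hlim0.eventually (gt_mem_nhds (half_pos hp0))
  have e2 := hlimi.eventually (lt_mem_nhds (half_lt_self hp0))
  have e3 := hlim0.eventually (gt_mem_nhds (half_pos hε))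
  have e4 := hlim.eventually (Metric.ball_mem_nhds p (half_pos hε))
  -- At this scale `q i` exceeds `Fintype.card I`, and the nearby point of color `i` falls in the
  -- ball missing `G i`.
  obtain ⟨k, h1, h2, h3, h4⟩ := (e1.and (e2.and (e3.and e4))).exists
  have hk : (0 : ℝ) < (φ k : ℝ) + 1 := by positivity
  rcases hq2 (φ k) i with h | ⟨x, hx, hnear⟩
  · have : (q (φ k) i : ℝ) ≤ Fintype.card I := by exact_mod_cast h
    exact absurd (h1.trans h2) (not_lt.2 (div_le_div_of_nonneg_right this hk.le))
  · refine hball ?_ hx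
    have hd : dist (fun j => (x j : ℝ) / ((φ k : ℝ) + 1))
        (fun j => (q (φ k) j : ℝ) / ((φ k : ℝ) + 1)) ≤ Fintype.card I / ((φ k : ℝ) + 1) := by
      refine (dist_pi_le_iff (by positivity)).2 fun j => ?_
      have ha : (x j : ℝ) ≤ q (φ k) j + Fintype.card I := by exact_mod_cast (hnear j).1
      have hb : (q (φ k) j : ℝ) ≤ x j + Fintype.card I := by exact_mod_cast (hnear j).2
      rw [Real.dist_eq, ← sub_div, abs_div, abs_of_pos hk]
      exact div_le_div_of_nonneg_right (abs_le.2 ⟨by linarith, by linarith⟩) hk.le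
    have h4' : dist (fun j => (q (φ k) j : ℝ) / ((φ k : ℝ) + 1)) p < ε / 2 := h4
    have := dist_triangle (fun j => (x j : ℝ) / ((φ k : ℝ) + 1))
      (fun j => (q (φ k) j : ℝ) / ((φ k : ℝ) + 1)) p
    rw [Metric.mem_ball]
    linarith

/-- The Knaster–Kuratowski–Mazurkiewicz lemma. -/
theorem knaster_kuratowski_mazurkiewicz {I : Type*} [Fintype I] [Nonempty I]
    (F : I → Set (I → ℝ)) (hF : ∀ i, IsClosed (F i))
    (hcover : ∀ x ∈ stdSimplex ℝ I, ∃ i, 0 < x i ∧ x ∈ F i) :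
    ∃ p ∈ stdSimplex ℝ I, ∀ i, p ∈ F i := by
  classical
  -- Nonemptiness of `F i` is needed because `infDist` to the empty set is 0.
  have hvertex : ∀ i, Pi.single i 1 ∈ F i := by
    intro i
    obtain ⟨j, hj, hjF⟩ := hcover _ (single_mem_stdSimplex ℝ i)
    have : j = i := by
      by_contra h
      simp [h] at hj
    exact this ▸ hjF
  rcases subsingleton_or_nontrivial I with hI | hI
  · have hp := single_mem_stdSimplex ℝ (Classical.arbitrary I)
    obtain ⟨j, -, hj⟩ := hcover _ hp
    exact ⟨_, hp, fun i => Subsingleton.elim j i ▸ hj⟩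
  · let d : I → (I → ℝ) → ℝ := fun i x => Metric.infDist x (F i)
    have hd : ∀ i, Continuous (d i) := fun i => Metric.continuous_infDist_pt _
    have hd0 : ∀ i x, 0 ≤ d i x := fun i x => Metric.infDist_nonneg
    -- At a common point the inequalities have equal sums, so all are equalities. Some `i` has `p i
    -- > 0` and `d i p = 0`, which makes every distance vanish.
    obtain ⟨p, hp, hpG⟩ := exists_mem_of_faces_subset
      (fun i => {x | x i * ∑ j, d j x ≤ d i x})
      (fun i => isClosed_le ((continuous_apply i).mul (continuous_finsetSum _ fun j _ => hd j))
        (hd i))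
      (by
        intro x hx
        by_contra hcon
        simp only [Set.mem_ofPred_eq, not_exists, not_le] at hcon
        have h := Finset.sum_lt_sum_of_nonempty Finset.univ_nonempty fun i _ => hcon i
        rw [← Finset.sum_mul, hx.2, one_mul] at h
        exact lt_irrefl _ h)
      (by
        intro x _ i hi
        simp only [Set.mem_ofPred_eq, hi, zero_mul]
        exact hd0 i x)
    have heq : ∀ i, p i * ∑ j, d j p = d i p := by
      have h := (Finset.sum_eq_sum_iff_of_le (s := Finset.univ)
        (f := fun i => p i * ∑ j, d j p) (g := fun i => d i p) fun i _ => hpG i).1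
        (by rw [← Finset.sum_mul, hp.2, one_mul])
      exact fun i => h i (Finset.mem_univ i)
    obtain ⟨i, hi, hiF⟩ := hcover p hp
    have hdi : d i p = 0 := Metric.infDist_zero_of_mem hiF
    have hS : ∑ j, d j p = 0 := by
      have := heq i
      rw [hdi] at this
      exact (mul_eq_zero.1 this).resolve_left hi.ne'
    refine ⟨p, hp, fun j => ?_⟩
    have hdj : d j p = 0 := by rw [← heq j, hS, mul_zero]
    exact ((hF j).mem_iff_infDist_zero ⟨_, hvertex j⟩).2 hdj

/-! ### Measures at which a lower semicontinuous test is at most 1 -/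

/-- The convex combination of point masses with weights `p`. -/
noncomputable def diracMixture {I : Type*} [Fintype I] (ω : I → Cantor) (p : stdSimplex ℝ I) :
    Measures :=
  ⟨∑ i, ENNReal.ofReal (p.1 i) • Measure.dirac (ω i), ⟨by
    simp only [Measure.coe_finsetSum, Finset.sum_apply, Measure.smul_apply, measure_univ,
      smul_eq_mul, mul_one]
    rw [← ENNReal.ofReal_sum_of_nonneg fun i _ => p.2.1 i, p.2.2, ENNReal.ofReal_one]⟩⟩

theorem lintegral_diracMixture {I : Type*} [Fintype I] (ω : I → Cantor) (p : stdSimplex ℝ I)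
    (f : Cantor → ℝ≥0∞) :
    ∫⁻ x, f x ∂(diracMixture ω p : Measure Cantor) = ∑ i, ENNReal.ofReal (p.1 i) * f (ω i) := by
  simp [diracMixture, lintegral_finsetSum_measure, lintegral_smul_measure, lintegral_dirac]

theorem continuous_diracMixture {I : Type*} [Fintype I] (ω : I → Cantor) :
    Continuous (diracMixture ω) := by
  rw [ProbabilityMeasure.continuous_iff_forall_continuous_lintegral]
  intro f
  simp only [lintegral_diracMixture]
  refine continuous_finsetSum _ fun i _ => ENNReal.continuous_mul_const ENNReal.coe_ne_top |>.comp
    (ENNReal.continuous_ofReal.comp ((continuous_apply i).comp continuous_subtype_val))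

theorem exists_forall_le_one_of_finite {t : Cantor → Measures → ℝ≥0∞}
    (hlsc : ∀ ω, LowerSemicontinuous (t ω))
    (hint : ∀ P : Measures, ∫⁻ ω, t ω P ∂(P : Measure Cantor) ≤ 1)
    {I : Type*} [Fintype I] [Nonempty I] (ω : I → Cantor) :
    ∃ N : Measures, ∀ i, t (ω i) N ≤ 1 := by
  have hclosed : ∀ i, IsClosed {p : stdSimplex ℝ I | t (ω i) (diracMixture ω p) ≤ 1} := fun i =>
    (LowerSemicontinuous.isClosed_preimage (hlsc (ω i)) 1).preimage (continuous_diracMixture ω)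
  obtain ⟨p, hp, hpF⟩ := knaster_kuratowski_mazurkiewicz
    (fun i => Subtype.val '' {p : stdSimplex ℝ I | t (ω i) (diracMixture ω p) ≤ 1})
    (fun i => (isClosed_stdSimplex ℝ I).isClosedEmbedding_subtypeVal.isClosedMap _ (hclosed i))
    (by
      intro x hx
      by_contra hcon
      push Not at hcon
      have hgt : ∀ i, 0 < x i → 1 < t (ω i) (diracMixture ω ⟨x, hx⟩) := fun i hi => by
        by_contra h
        exact hcon i hi ⟨⟨x, hx⟩, not_lt.1 h, rfl⟩
      have h1 := hint (diracMixture ω ⟨x, hx⟩)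
      rw [lintegral_diracMixture] at h1
      have h2 : ∑ i, ENNReal.ofReal (x i) = 1 := by
        rw [← ENNReal.ofReal_sum_of_nonneg fun i _ => hx.1 i, hx.2, ENNReal.ofReal_one]
      have hle : ∀ i, ENNReal.ofReal (x i) ≤
          ENNReal.ofReal (x i) * t (ω i) (diracMixture ω ⟨x, hx⟩) := by
        intro i
        rcases (hx.1 i).eq_or_lt with h | h
        · simp [← h]
        · exact le_mul_of_one_le_right' (hgt i h).le
      obtain ⟨i, hi⟩ : ∃ i, 0 < x i := by
        by_contra h
        push Not at h
        have h3 := hx.2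
        rw [Finset.sum_eq_zero fun i _ => le_antisymm (h i) (hx.1 i)] at h3
        exact zero_ne_one h3
      have hlt : ENNReal.ofReal (x i) <
          ENNReal.ofReal (x i) * t (ω i) (diracMixture ω ⟨x, hx⟩) := by
        have := ENNReal.mul_lt_mul_right (a := ENNReal.ofReal (x i))
          (ENNReal.ofReal_pos.2 hi).ne' ENNReal.ofReal_ne_top (hgt i hi)
        rwa [mul_one] at this
      have h4 : ∑ i, ENNReal.ofReal (x i) <
          ∑ i, ENNReal.ofReal (x i) * t (ω i) (diracMixture ω ⟨x, hx⟩) := by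
        classical
        rw [← Finset.add_sum_erase _ _ (Finset.mem_univ i),
          ← Finset.add_sum_erase _ _ (Finset.mem_univ i)]
        refine ENNReal.add_lt_add_of_lt_of_le ?_ hlt (Finset.sum_le_sum fun j _ => hle j)
        exact (ENNReal.sum_lt_top.2 fun j _ => ENNReal.ofReal_lt_top).ne
      rw [h2] at h4
      exact not_le.2 h4 h1)
  refine ⟨diracMixture ω ⟨p, hp⟩, fun i => ?_⟩
  obtain ⟨q, hq, hqp⟩ := hpF i
  have : q = ⟨p, hp⟩ := Subtype.ext hqp
  exact this ▸ hq

theorem exists_forall_le_one {t : Cantor → Measures → ℝ≥0∞}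
    (hlsc : ∀ ω, LowerSemicontinuous (t ω))
    (hint : ∀ P : Measures, ∫⁻ ω, t ω P ∂(P : Measure Cantor) ≤ 1) :
    ∃ N : Measures, ∀ ω, t ω N ≤ 1 := by
  have h := CompactSpace.iInter_nonempty (t := fun ω => {N : Measures | t ω N ≤ 1})
    (fun ω => (hlsc ω).isClosed_preimage 1) (by
      intro s
      rcases s.eq_empty_or_nonempty with rfl | hs
      · simp
      · have : Nonempty s := hs.to_subtype
        obtain ⟨N, hN⟩ := exists_forall_le_one_of_finite hlsc hint (fun i : s => i.1)
        exact ⟨N, by simpa using hN⟩)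
  obtain ⟨N, hN⟩ := h
  exact ⟨N, fun ω => by simpa using Set.mem_iInter.1 hN ω⟩

/-! ### Lower semicontinuity and countability of tests -/

theorem isClopen_interval (x : List Bool) : IsClopen (interval x) := by
  have : interval x = ⋂ i : Fin x.length, (fun ω : Cantor => ω i) ⁻¹' {x.get i} := by
    ext ω
    simp [interval]
  rw [this]
  exact isClopen_iInter_of_finite fun i => (isClopen_discrete _).preimage (continuous_apply _)

theorem continuous_measureReal_interval (x : List Bool) :
    Continuous fun P : Measures => (P : Measure Cantor).real (interval x) := by
  have h : Continuous fun P : Measures => P (interval x) := continuous_iff_continuousAt.2 fun _ =>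
    ProbabilityMeasure.tendsto_measure_of_isClopen_of_tendsto Filter.tendsto_id
      (isClopen_interval x)
  exact NNReal.continuous_coe.comp h

theorem isOpen_basicMeasures (β : MeasureCode) : IsOpen (basicMeasures β) := by
  induction β with
  | nil => simp [basicMeasures]
  | cons c β ih =>
    have : basicMeasures (c :: β) =
        {P : Measures | (c.2.1.val : ℝ) < (P : Measure Cantor).real (interval c.1) ∧
          (P : Measure Cantor).real (interval c.1) < (c.2.2.val : ℝ)} ∩ basicMeasures β := by
      ext P
      simp only [basicMeasures, List.forall_mem_cons, Set.mem_inter_iff, Set.mem_ofPred_eq]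
    rw [this]
    exact ((isOpen_lt continuous_const (continuous_measureReal_interval _)).inter
      (isOpen_lt (continuous_measureReal_interval _) continuous_const)).inter ih

theorem isOpen_basicRect (b : RectCode) : IsOpen (basicRect b) :=
  (isClopen_interval b.1).isOpen.prod (isOpen_basicMeasures b.2)

theorem RatCode.exists_val_eq (q : ℚ) : ∃ c : RatCode, c.val = q := by
  refine ⟨(q.num.toNat, (-q.num).toNat, q.den - 1), ?_⟩
  have h1 : ((q.num.toNat : ℚ)) - ((-q.num).toNat : ℚ) = (q.num : ℚ) := by
    have : (q.num.toNat : ℤ) - ((-q.num).toNat : ℤ) = q.num := by omega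
    exact_mod_cast this
  have h2 : ((q.den - 1 : ℕ) : ℚ) + 1 = q.den := by
    have := q.pos
    exact_mod_cast Nat.sub_add_cancel this
  simp only [RatCode.val, h1, h2]
  exact q.num_div_den

theorem LowerSemicomputable.lowerSemicontinuous {t : Cantor → Measures → ℝ≥0∞}
    (ht : LowerSemicomputable t) :
    LowerSemicontinuous fun p : Cantor × Measures => t p.1 p.2 := by
  obtain ⟨W, -, hW⟩ := ht
  intro p a ha
  obtain ⟨q, hq1, hq2⟩ := EReal.lt_iff_exists_rat_btwn.1 (EReal.coe_ennreal_lt_coe_ennreal_iff.2 ha)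
  obtain ⟨c, rfl⟩ := RatCode.exists_val_eq q
  have hopen : IsOpen {p : Cantor × Measures |
      (((c.val : ℚ) : ℝ) : EReal) < ((t p.1 p.2 : ℝ≥0∞) : EReal)} := by
    rw [hW c]
    exact isOpen_biUnion fun b _ => isOpen_basicRect b
  filter_upwards [hopen.mem_nhds hq2] with p' hp'
  exact EReal.coe_ennreal_lt_coe_ennreal_iff.1 (hq1.trans hp')

/-- Each such predicate is the domain of a partial recursive function, and these have countably many
codes. -/
theorem countable_setOf_rePred {α : Type*} [Primcodable α] :
    {W : α → Prop | REPred W}.Countable := by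
  have h : ∀ W : {W : α → Prop | REPred W}, ∃ c : Nat.Partrec.Code, c.eval = fun n =>
      Part.bind (Encodable.decode (α := α) n : Option α)
        fun a => (Part.assert (W.1 a) fun _ => Part.some ()).map Encodable.encode := fun W =>
    Nat.Partrec.Code.exists_code.1 W.2
  choose code hcode using h
  refine Set.countable_coe_iff.1 (Function.Injective.countable (f := code) fun V W hVW => ?_)
  have h := (hcode V).symm.trans ((congrArg _ hVW).trans (hcode W))
  ext a
  have ha := congrArg (fun f => (f (Encodable.encode a)).Dom) h
  simpa [Part.assert, Part.some] using ha

theorem countable_setOf_lowerSemicomputable :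
    {t : Cantor → Measures → ℝ≥0∞ | LowerSemicomputable t}.Countable := by
  have := (countable_setOf_rePred (α := RatCode × RectCode)).to_subtype
  have h : ∀ t : {t : Cantor → Measures → ℝ≥0∞ | LowerSemicomputable t},
      ∃ W : {W : RatCode × RectCode → Prop | REPred W}, ∀ r : RatCode,
        {p : Cantor × Measures | (((r.val : ℚ) : ℝ) : EReal) < ((t.1 p.1 p.2 : ℝ≥0∞) : EReal)} =
          ⋃ b ∈ {b : RectCode | W.1 (r, b)}, basicRect b := fun t =>
    let ⟨W, hW, h⟩ := t.2
    ⟨⟨W, hW⟩, h⟩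
  choose W hW using h
  refine Set.countable_coe_iff.1 (Function.Injective.countable (f := W) fun s t hst => ?_)
  have key : ∀ (r : RatCode) (p : Cantor × Measures),
      (((r.val : ℚ) : ℝ) : EReal) < ((s.1 p.1 p.2 : ℝ≥0∞) : EReal) ↔
        (((r.val : ℚ) : ℝ) : EReal) < ((t.1 p.1 p.2 : ℝ≥0∞) : EReal) := by
    intro r p
    have h1 := hW s r
    rw [hst, ← hW t r] at h1
    exact Set.ext_iff.1 h1 p
  have hle : ∀ a b : EReal, (∀ r : RatCode, (((r.val : ℚ) : ℝ) : EReal) < a →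
      (((r.val : ℚ) : ℝ) : EReal) < b) → a ≤ b := by
    intro a b h
    by_contra hab
    obtain ⟨q, hq1, hq2⟩ := EReal.lt_iff_exists_rat_btwn.1 (not_le.1 hab)
    obtain ⟨c, rfl⟩ := RatCode.exists_val_eq q
    exact lt_asymm hq1 (h c hq2)
  refine Subtype.ext (funext fun ω => funext fun P => ?_)
  exact EReal.coe_ennreal_eq_coe_ennreal_iff.1
    (le_antisymm (hle _ _ fun r => (key r (ω, P)).1) (hle _ _ fun r => (key r (ω, P)).2))

theorem IsUniformTest.lowerSemicontinuous {t : Cantor → Measures → ℝ≥0∞} (ht : IsUniformTest t)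
    (ω : Cantor) : LowerSemicontinuous (t ω) := fun P a h =>
  (show Continuous fun P : Measures => (ω, P) by fun_prop).continuousAt.eventually
    (ht.lowerSemicomputable.lowerSemicontinuous (ω, P) a h)

theorem IsUniformTest.measurable {t : Cantor → Measures → ℝ≥0∞} (ht : IsUniformTest t)
    (P : Measures) : Measurable fun ω => t ω P :=
  LowerSemicontinuous.measurable fun ω a h =>
    (show Continuous fun ω : Cantor => (ω, P) by fun_prop).continuousAt.eventually
      (ht.lowerSemicomputable.lowerSemicontinuous (ω, P) a h)

/-! ### Neutral measures -/

theorem exists_isNeutral : ∃ N : Measures, IsNeutral N := by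
  let ι := {t : Cantor → Measures → ℝ≥0∞ // IsUniformTest t}
  have : Countable ι := Set.countable_coe_iff.2
    (countable_setOf_lowerSemicomputable.mono fun t ht => IsUniformTest.lowerSemicomputable ht)
  -- Weights of total less than 1 keep the integral of the sum at most 1; their positivity makes a
  -- bound on the sum force every single test to be finite.
  obtain ⟨w, hw, hsum⟩ := ENNReal.exists_pos_sum_of_countable one_ne_zero ι
  obtain ⟨N, hN⟩ := exists_forall_le_one (t := fun ω P => ∑' t : ι, (w t : ℝ≥0∞) * t.1 ω P)
    (fun ω => lowerSemicontinuous_tsum fun t =>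
      (ENNReal.continuous_const_mul ENNReal.coe_ne_top).comp_lowerSemicontinuous
        (t.2.lowerSemicontinuous ω) fun _ _ h => mul_le_mul_right h _)
    (fun P => by
      rw [lintegral_tsum fun t => ((t.2.measurable P).const_mul _).aemeasurable]
      refine le_trans (ENNReal.tsum_le_tsum fun t => ?_) hsum.le
      rw [lintegral_const_mul _ (t.2.measurable P)]
      exact mul_le_of_le_one_right' (t.2.lintegral_le_one P))
  refine ⟨N, fun ω s hs => ?_⟩
  have h1 : (w ⟨s, hs⟩ : ℝ≥0∞) * s ω N ≤ 1 :=
    (ENNReal.le_tsum (f := fun t : ι => (w t : ℝ≥0∞) * t.1 ω N) ⟨s, hs⟩).trans (hN ω)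
  by_contra h
  rw [not_lt, top_le_iff] at h
  rw [h, ENNReal.mul_top (by exact_mod_cast (hw _).ne')] at h1
  exact absurd h1 (by simp)

end UniformTests

theorem mainTheorem9 :
    (∃ N : UniformTests.Measures, UniformTests.IsNeutral N) ∧
    ∀ t : UniformTests.Cantor → UniformTests.Measures → ℝ≥0∞,
      UniformTests.IsUniversalUniformTest t →
        ∃ N : UniformTests.Measures,
          (∀ ω : UniformTests.Cantor, t ω N ≤ 1) ∧ UniformTests.IsNeutral N := by
  refine ⟨UniformTests.exists_isNeutral, fun t ht => ?_⟩
  obtain ⟨N, hN⟩ := UniformTests.exists_forall_le_one (fun ω => ht.isUniformTest.lowerSemicontinuous ω)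
    ht.isUniformTest.lintegral_le_one
  exact ⟨N, hN, fun ω =>
    (UniformTests.isUniformlyRandom_iff ht ω N).2 ((hN ω).trans_lt ENNReal.one_lt_top)⟩
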